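/- Let $d\in\{1,2,3\}$ and let $\Omega\subset\mathbb{R}^d$ be a nonempty bounded open set (no regularity of $\partial\Omega$ is needed; in particular $\Omega$ may be a smooth bounded domain). Let $\mathcal{U}=H^1_0(\Omega)$ be the closure of $C_c^\infty(\Omega)$ in the norm $\|u\|_{\mathcal U}^2=\|u\|_{L^2(\Omega)}^2+\|\nabla u\|_{L^2(\Omega)}^2$, and let $\mathcal{U}^*$ be its dual. Fix constants $\kappa_0,\alpha,m_{\mathrm{lw}}>0$ and $f\in L^2(\Omega)$, and let $\mathcal{M}=\{m\in L^2(\Omega)\cap L^\infty(\Omega): m\ge m_{\mathrm{lw}}\text{ a.e.}\}$. There are constants $C_P>0$ with $\|u\|_{L^2(\Omega)}\le C_P\|\nabla u\|_{L^2(\Omega)}$ and $C_S>0$ with $\|u\|_{L^4(\Omega)}\le C_S\|u\|_{\mathcal U}$ for all $u\in\mathcal{U}$, depending only on $\Omega$. For every $m\in\mathcal{M}$ the residual $\mathcal{R}(m,\cdot):\mathcal{U}\to\mathcal{U}^*$ of $-\nabla\cdot(\kappa_0 m\nabla u)+\alpha u^3=f$, $$\langle v,\mathcal{R}(m,u)\rangle=\int_\Omega\{\kappa_0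 m\nabla u\cdot\nabla v+\alpha u^3v\}\,dx-\int_\Omega fv\,dx ,$$ is well defined, and it is twice Gâteaux differentiable in $u$ with derivatives $$\langle v,\delta_u\mathcal{R}(m,u)(p)\rangle=\int_\Omega\{\kappa_0 m\nabla p\cdot\nabla v+3\alpha u^2pv\}\,dx,\qquad \langle v,\delta_u^2\mathcal{R}(m,u)(p,q)\rangle=\int_\Omega 6\alpha\,u\,p\,q\,v\,dx ,$$ all integrals being absolutely convergent. Moreover, for every such pair of constants $C_P,C_S$ and every $\tilde u\in\mathcal{U}$, with $$\hat C=\frac{\kappa_0m_{\mathrm{lw}}}{2}\min\{1,C_P^{-2}\},\qquad \bar C(\tilde u)=\kappa_0\|m\|_{L^\infty(\Omega)}+3\alpha C_S^4\|\tilde u\|_{\mathcal U}^2,\qquad \bar C_2(\tilde u)=6\alpha C_S^4\|\tilde u\|_{\mathcal U},$$ the following hold. (i) $\hat C\|v\|_{\mathcal U}\le\|\delta_u\mathcal{R}(m,\tilde u)(v)\|_{\mathcal U^*}\le\bar C(\tilde u)\|v\|_{\mathcal U}$ for all $v\in\mathcal{U}$, and $\hat C\le\|\delta_u\mathcal{R}(m,\tilde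 u)\|_{\mathcal L(\mathcal U;\mathcal U^*)}\le\bar C(\tilde u)$. (ii) $\delta_u\mathcal{R}(m,\tilde u):\mathcal{U}\to\mathcal{U}^*$ is invertible, with $\|\delta_u\mathcal{R}(m,\tilde u)^{-1}\|_{\mathcal L(\mathcal U^*;\mathcal U)}\le 1/\hat C$. (iii) $\|\delta_u^2\mathcal{R}(m,\tilde u)(p,q)\|_{\mathcal U^*}\le\bar C_2(\tilde u)\|p\|_{\mathcal U}\|q\|_{\mathcal U}$ for all $p,q\in\mathcal{U}$, and $\|\delta_u^2\mathcal{R}(m,\tilde u)\|_{\mathcal L(\mathcal U\times\mathcal U;\mathcal U^*)}\le\bar C_2(\tilde u)$. -/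

import Mathlib

open MeasureTheory
open scoped ENNReal ContDiff

set_option maxSynthPendingDepth 3

noncomputable section

namespace NonlinearDiffusion

/-- `ℝᵈ` with its Euclidean norm. -/
abbrev E (d : ℕ) : Type := EuclideanSpace ℝ (Fin d)

/-- Lebesgue measure on `Ω`. -/
abbrev vol {d : ℕ} (Ω : Set (E d)) : Measure (E d) := volume.restrict Ω

/-- The Hilbert space `L²(Ω) × L²(Ω; ℝᵈ)` with `‖(u, g)‖² = ‖u‖² + ‖g‖²`. -/
abbrev PairSpace {d : ℕ} (Ω : Set (E d)) : Type :=
  WithLp 2 (Lp ℝ 2 (vol Ω) × Lp (E d) 2 (vol Ω))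

/-- `φ ∈ C_c^∞(Ω)`, as a function on `ℝᵈ` that vanishes outside of a compact subset of `Ω`. -/
structure IsTestFunction {d : ℕ} (Ω : Set (E d)) (φ : E d → ℝ) : Prop where
  smooth : ContDiff ℝ ∞ φ
  compact : HasCompactSupport φ
  support_subset : tsupport φ ⊆ Ω

/-- The pairs `(φ, ∇φ)` with `φ ∈ C_c^∞(Ω)`. -/
def testPairs {d : ℕ} (Ω : Set (E d)) : Submodule ℝ (PairSpace Ω) where
  carrier := {U | ∃ φ : E d → ℝ, IsTestFunction Ω φ ∧
    U.fst =ᵐ[vol Ω] φ ∧ U.snd =ᵐ[vol Ω] gradient φ}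
  zero_mem' := by
    refine ⟨fun _ => 0, ⟨contDiff_const, HasCompactSupport.zero, ?_⟩, ?_, ?_⟩
    · simp [tsupport]
    · exact Lp.coeFn_zero _ _ _
    · have h : gradient (fun _ : E d => (0 : ℝ)) = 0 := by
        ext1 x
        exact gradient_const x 0
      rw [h]
      exact Lp.coeFn_zero _ _ _
  add_mem' := by
    rintro U V ⟨φ, hφ, h1, h2⟩ ⟨ψ, hψ, h3, h4⟩
    refine ⟨φ + ψ, ⟨hφ.smooth.add hψ.smooth, hφ.compact.add hψ.compact, ?_⟩, ?_, ?_⟩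
    · exact (tsupport_add φ ψ).trans (Set.union_subset hφ.support_subset hψ.support_subset)
    · exact (Lp.coeFn_add _ _).trans (h1.add h3)
    · have h : gradient (φ + ψ) = gradient φ + gradient ψ := by
        ext1 x
        simp only [gradient, Pi.add_apply]
        rw [fderiv_add (hφ.smooth.differentiable (by simp) x)
          (hψ.smooth.differentiable (by simp) x), map_add]
      rw [h]
      exact (Lp.coeFn_add _ _).trans (h2.add h4)
  smul_mem' := by
    rintro c U ⟨φ, hφ, h1, h2⟩
    refine ⟨c • φ, ⟨contDiff_const.smul hφ.smooth, hφ.compact.smul_left, ?_⟩, ?_, ?_⟩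
    · exact (tsupport_smul_subset_right (fun _ => c) φ).trans hφ.support_subset
    · exact (Lp.coeFn_smul _ _).trans (h1.const_smul c)
    · have h : gradient (c • φ) = c • gradient φ := by
        ext1 x
        simp only [gradient, Pi.smul_apply]
        rw [fderiv_const_smul (hφ.smooth.differentiable (by simp) x), map_smul]
      rw [h]
      exact (Lp.coeFn_smul _ _).trans (h2.const_smul c)

/-- The Sobolev space `H¹₀(Ω)`: the closure of `C_c^∞(Ω)` in the norm
`‖u‖² = ‖u‖²_{L²} + ‖∇u‖²_{L²}`. An element is stored together with its weak gradient
(see `weak_gradient`). -/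
abbrev H10 {d : ℕ} (Ω : Set (E d)) : Type := (testPairs Ω).topologicalClosure

/-- The underlying `L²` function of `u ∈ H¹₀(Ω)`. -/
def H10.toL2 {d : ℕ} {Ω : Set (E d)} (u : H10 Ω) : Lp ℝ 2 (vol Ω) := u.1.fst

/-- The weak gradient of `u ∈ H¹₀(Ω)`. -/
def H10.grad {d : ℕ} {Ω : Set (E d)} (u : H10 Ω) : Lp (E d) 2 (vol Ω) := u.1.snd

/-- `H10.grad u` is indeed the weak gradient of `u`. -/
theorem weak_gradient {d : ℕ} {Ω : Set (E d)} (u : H10 Ω) {φ : E d → ℝ}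
    (hφ : IsTestFunction Ω φ) (a : E d) :
    ∫ x in Ω, u.toL2 x * fderiv ℝ φ x a = - ∫ x in Ω, inner ℝ (u.grad x) a * φ x := by
  have hc1 : Continuous (fun x => fderiv ℝ φ x a) :=
    (hφ.smooth.continuous_fderiv (by simp)).clm_apply continuous_const
  have hs1 : HasCompactSupport (fun x => fderiv ℝ φ x a) := hφ.compact.fderiv_apply ℝ a
  have hM1 : MemLp (fun x => fderiv ℝ φ x a) 2 (vol Ω) :=
    (hc1.memLp_of_hasCompactSupport hs1).restrict Ω
  have hM2 : MemLp (fun x => φ x • a) 2 (vol Ω) :=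
    ((hφ.smooth.continuous.smul continuous_const).memLp_of_hasCompactSupport
      hφ.compact.smul_right).restrict Ω
  -- both sides as continuous functions on the pair space
  let F : PairSpace Ω → ℝ := fun U => inner ℝ (hM1.toLp _) U.fst + inner ℝ (hM2.toLp _) U.snd
  have hF : ∀ U : PairSpace Ω, F U =
      (∫ x in Ω, U.fst x * fderiv ℝ φ x a) + ∫ x in Ω, inner ℝ (U.snd x) a * φ x := by
    intro U
    simp only [F, L2.inner_def]
    congr 1
    · refine integral_congr_ae ?_
      filter_upwards [hM1.coeFn_toLp] with x hx
      simp [hx]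
    · refine integral_congr_ae ?_
      filter_upwards [hM2.coeFn_toLp] with x hx
      simp only [hx, real_inner_smul_left, real_inner_comm a]
      rw [mul_comm]
  have hFc : Continuous F := by
    have h1 : Continuous (fun U : PairSpace Ω => U.fst) := by fun_prop
    have h2 : Continuous (fun U : PairSpace Ω => U.snd) := by fun_prop
    exact (continuous_const.inner h1).add (continuous_const.inner h2)
  have hz : ∀ U ∈ testPairs Ω, F U = 0 := by
    rintro U ⟨ψ, hψ, h1, h2⟩
    rw [hF]
    have e1 : ∫ x in Ω, U.fst x * fderiv ℝ φ x a = ∫ x, ψ x * fderiv ℝ φ x a := by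
      rw [integral_congr_ae (g := fun x => ψ x * fderiv ℝ φ x a)
        (by filter_upwards [h1] with x hx; rw [hx])]
      refine setIntegral_eq_integral_of_forall_compl_eq_zero (fun x hx => ?_)
      rw [image_eq_zero_of_notMem_tsupport (fun h => hx (hψ.support_subset h)), zero_mul]
    have e2 : ∫ x in Ω, inner ℝ (U.snd x) a * φ x = ∫ x, fderiv ℝ ψ x a * φ x := by
      rw [integral_congr_ae (g := fun x => fderiv ℝ ψ x a * φ x)
        (by
          filter_upwards [h2] with x hx
          rw [hx]
          simp [gradient])]
      refine setIntegral_eq_integral_of_forall_compl_eq_zero (fun x hx => ?_)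
      rw [image_eq_zero_of_notMem_tsupport (fun h => hx (hφ.support_subset h)), mul_zero]
    rw [e1, e2]
    have hc2 : Continuous (fun x => fderiv ℝ ψ x a) :=
      (hψ.smooth.continuous_fderiv (by simp)).clm_apply continuous_const
    have hs2 : HasCompactSupport (fun x => fderiv ℝ ψ x a) := hψ.compact.fderiv_apply ℝ a
    rw [integral_mul_fderiv_eq_neg_fderiv_mul_of_integrable]
    · ring
    · exact (hc2.mul hφ.smooth.continuous).integrable_of_hasCompactSupport hs2.mul_right
    · exact (hψ.smooth.continuous.mul hc1).integrable_of_hasCompactSupport hψ.compact.mul_right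
    · exact (hψ.smooth.continuous.mul hφ.smooth.continuous).integrable_of_hasCompactSupport
        hψ.compact.mul_right
    · exact fun x _ => hψ.smooth.differentiable (by simp) x
    · exact fun x _ => hφ.smooth.differentiable (by simp) x
  have hu : F u.1 = 0 := by
    have hcl : IsClosed {U | F U = 0} := isClosed_eq hFc continuous_const
    exact closure_minimal hz hcl u.2
  rw [hF] at hu
  exact eq_neg_of_add_eq_zero_left hu

/-- `C` is a constant in the Poincaré inequality `‖u‖_{L²} ≤ C ‖∇u‖_{L²}` on `H¹₀(Ω)`. -/
def IsPoincareConstant {d : ℕ} (Ω : Set (E d)) (C : ℝ) : Prop :=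
  0 < C ∧ ∀ u : H10 Ω, ‖u.toL2‖ ≤ C * ‖u.grad‖

/-- `C` is a constant of the embedding `H¹₀(Ω) ↪ L⁴(Ω)`: `‖u‖_{L⁴} ≤ C ‖u‖_{H¹}`. -/
def IsSobolevConstant {d : ℕ} (Ω : Set (E d)) (C : ℝ) : Prop :=
  0 < C ∧ ∀ u : H10 Ω, eLpNorm u.toL2 4 (vol Ω) ≤ ENNReal.ofReal (C * ‖u‖)

/-- The set `{m ∈ L²(Ω) ∩ L^∞(Ω) : m ≥ m_lw a.e.}` of diffusivities. -/
def diffusivities {d : ℕ} (Ω : Set (E d)) (mlw : ℝ) : Set (Lp ℝ ∞ (vol Ω)) :=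
  {m | MemLp m 2 (vol Ω) ∧ ∀ᵐ x ∂(vol Ω), mlw ≤ m x}

/-- The topological dual of `H¹₀(Ω)`, with the operator norm. -/
abbrev DualH10 {d : ℕ} (Ω : Set (E d)) : Type := StrongDual ℝ (H10 Ω)

/-- The integrand `κ₀ m ∇u·∇v + α u³ v` of the semilinear form. -/
def formIntegrand {d : ℕ} {Ω : Set (E d)} (κ₀ α : ℝ) (m : Lp ℝ ∞ (vol Ω)) (u v : H10 Ω)
    (x : E d) : ℝ :=
  κ₀ * m x * inner ℝ (u.grad x) (v.grad x) + α * (u.toL2 x) ^ 3 * v.toL2 x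

/-- `R = R(m, ·) : H¹₀(Ω) → H¹₀(Ω)*` is the residual operator of the weak form of
`-∇·(κ₀ m ∇u) + α u³ = f`; the integrals that define it converge. -/
def IsResidual {d : ℕ} {Ω : Set (E d)} (κ₀ α : ℝ) (f : Lp ℝ 2 (vol Ω))
    (m : Lp ℝ ∞ (vol Ω)) (R : H10 Ω → DualH10 Ω) : Prop :=
  ∀ u v : H10 Ω,
    Integrable (formIntegrand κ₀ α m u v) (vol Ω) ∧
    Integrable (fun x => f x * v.toL2 x) (vol Ω) ∧
    R u v = (∫ x in Ω, formIntegrand κ₀ α m u v x) - ∫ x in Ω, f x * v.toL2 x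

/-- The integrand `κ₀ m ∇p·∇v + 3 α u² p v` of the first derivative. -/
def firstIntegrand {d : ℕ} {Ω : Set (E d)} (κ₀ α : ℝ) (m : Lp ℝ ∞ (vol Ω)) (u p v : H10 Ω)
    (x : E d) : ℝ :=
  κ₀ * m x * inner ℝ (p.grad x) (v.grad x) + 3 * α * (u.toL2 x) ^ 2 * p.toL2 x * v.toL2 x

/-- The integrand `6 α u p q v` of the second derivative. -/
def secondIntegrand {d : ℕ} {Ω : Set (E d)} (α : ℝ) (u p q v : H10 Ω) (x : E d) : ℝ :=
  6 * α * u.toL2 x * p.toL2 x * q.toL2 x * v.toL2 x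

/-- `DR u : p ↦ lim_{ε → 0} (R(u + ε p) - R(u)) / ε` (limit in the dual norm), continuous and
linear in `p`. -/
def IsFirstVariation {d : ℕ} {Ω : Set (E d)} (R : H10 Ω → DualH10 Ω)
    (DR : H10 Ω → H10 Ω →L[ℝ] DualH10 Ω) : Prop :=
  ∀ u p : H10 Ω, HasLineDerivAt ℝ R (DR u p) u p

/-- `D2R u : (p, q) ↦ lim_{ε → 0} (DR(u + ε q)(p) - DR(u)(p)) / ε` (limit in the dual norm),
continuous and bilinear in `(p, q)`. -/
def IsSecondVariation {d : ℕ} {Ω : Set (E d)} (DR : H10 Ω → H10 Ω →L[ℝ] DualH10 Ω)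
    (D2R : H10 Ω → H10 Ω →L[ℝ] H10 Ω →L[ℝ] DualH10 Ω) : Prop :=
  ∀ u p q : H10 Ω, HasLineDerivAt ℝ (fun w => DR w p) (D2R u p q) u q

/-- The lower constant `(κ₀ m_lw / 2) min{1, C_P⁻²}`. -/
def lowerConst (κ₀ mlw CP : ℝ) : ℝ := κ₀ * mlw / 2 * min 1 ((CP ^ 2)⁻¹)

/-- The upper constant `κ₀ ‖m‖_∞ + 3 α C_S⁴ ‖u‖²`. -/
def upperConst {d : ℕ} {Ω : Set (E d)} (κ₀ α CS : ℝ) (m : Lp ℝ ∞ (vol Ω)) (u : H10 Ω) : ℝ :=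
  κ₀ * ‖m‖ + 3 * α * CS ^ 4 * ‖u‖ ^ 2

/-- The constant `6 α C_S⁴ ‖u‖` for the second derivative. -/
def secondConst {d : ℕ} {Ω : Set (E d)} (α CS : ℝ) (u : H10 Ω) : ℝ :=
  6 * α * CS ^ 4 * ‖u‖

end NonlinearDiffusion

end

/-! ### Sobolev and Poincaré inequalities on a bounded set -/

noncomputable section

namespace NonlinearDiffusion

open Filter Topology NNReal

variable {d : ℕ} {Ω : Set (E d)}

/-! Everything rests on the embedding of `H10 Ω` into L⁴. It gives u p ∈ L² for u, p in `H10 Ω`, so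
∫ u p q v is the L² inner product of u p and q v: a bounded, symmetric form with constant C_S⁴
(`norm_quarticForm_le`). The residual is then a bounded linear map plus the diagonal of a bounded
trilinear map minus a constant. Along any line it is a cubic polynomial in the parameter, and both
Gâteaux derivatives are read off from its coefficients (`hasDerivAt_cubic_zero`).

The upper bounds are Cauchy-Schwarz and Hölder. For the lower bounds, the cubic term contributes
3α∫u²v² ≥ 0 to the linearization tested with v, so it can be dropped; the diffusion term and the
Poincaré inequality give coercivity (`residualDeriv_coercive`). Lax-Milgram then yields
invertibility and the bound on the inverse.

The embedding is proved for test functions and passed to the closure by Fatou's lemma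
(`exists_sobolev_grad`). All test functions vanish off Ω, so no boundary regularity enters. Poincaré
follows from the same estimate by Hölder on the bounded set Ω. -/

theorem enorm_gradient (φ : E d → ℝ) (x : E d) :
    ‖gradient φ x‖ₑ = ‖fderiv ℝ φ x‖ₑ := by
  simp [gradient, enorm, nnnorm]

/-- The derivative is supported in Ω, so its norm over the whole space is its norm over Ω, where
Hölder compares exponents p ≤ 2. -/
theorem IsTestFunction.eLpNorm_fderiv_le {φ : E d → ℝ} (hφ : IsTestFunction Ω φ) {p : ℝ≥0∞}
    (hp : p ≤ 2) :
    eLpNorm (fderiv ℝ φ) p volume ≤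
      eLpNorm (gradient φ) 2 (vol Ω) * volume Ω ^ (1 / p.toReal - 1 / 2) := by
  have hs : Function.support (fderiv ℝ φ) ⊆ Ω :=
    (support_fderiv_subset ℝ).trans hφ.support_subset
  have hm : AEStronglyMeasurable (fderiv ℝ φ) (vol Ω) :=
    (hφ.smooth.continuous_fderiv (by simp)).aestronglyMeasurable
  have h := eLpNorm_le_eLpNorm_mul_rpow_measure_univ hp hm
  rw [eLpNorm_restrict_eq_of_support_subset hs] at h
  have hg : eLpNorm (gradient φ) 2 (vol Ω) = eLpNorm (fderiv ℝ φ) 2 (vol Ω) :=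
    eLpNorm_congr_enorm_ae (.of_forall (enorm_gradient φ))
  rw [hg]
  simpa using h

/-- On the line, a test function is bounded by the `L¹` norm of its derivative. -/
theorem IsTestFunction.enorm_le_eLpNorm_fderiv_one {Ω : Set (E 1)} {φ : E 1 → ℝ}
    (hφ : IsTestFunction Ω φ) (x : E 1) : ‖φ x‖ₑ ≤ eLpNorm (fderiv ℝ φ) 1 volume := by
  let b : OrthonormalBasis (Fin 1) ℝ ℝ := OrthonormalBasis.singleton (Fin 1) ℝ
  let e : ℝ ≃ₗᵢ[ℝ] E 1 := b.repr
  have hc : ContDiff ℝ 1 (φ ∘ e) :=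
    (hφ.smooth.of_le (by simp)).comp e.toContinuousLinearEquiv.contDiff
  have hs : HasCompactSupport (φ ∘ e) := hφ.compact.comp_homeomorph e.toHomeomorph
  have h := hs.enorm_le_lintegral_Ici_deriv hc (e.symm x)
  simp only [Function.comp_apply, LinearIsometryEquiv.apply_symm_apply] at h
  refine h.trans ((setLIntegral_le_lintegral _ _).trans ?_)
  rw [eLpNorm_one_eq_lintegral_enorm,
    ← b.measurePreserving_repr.lintegral_comp_emb e.toHomeomorph.measurableEmbedding]
  refine lintegral_mono fun t => ?_
  -- Since `e` is an isometry, `e 1` is a unit vector, so this derivative is bounded by the operator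
  -- norm of the Fréchet derivative.
  have hd : deriv (φ ∘ e) t = fderiv ℝ φ (e t) (e 1) := by
    refine HasDerivAt.deriv ?_
    exact ((hφ.smooth.differentiable (by simp) (e t)).hasFDerivAt).comp_hasDerivAt t
      (e.toContinuousLinearEquiv.toContinuousLinearMap.hasDerivAt)
  rw [hd, ← ofReal_norm, ← ofReal_norm]
  refine ENNReal.ofReal_le_ofReal (((fderiv ℝ φ (e t)).le_opNorm _).trans ?_)
  simp [b, e]

theorem exists_sobolev_testFunction (hd1 : 1 ≤ d) (hd3 : d ≤ 3)
    (hΩ : Bornology.IsBounded Ω) :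
    ∃ C : ℝ≥0, ∀ φ : E d → ℝ, IsTestFunction Ω φ →
      eLpNorm φ 4 (vol Ω) ≤ C * eLpNorm (gradient φ) 2 (vol Ω) := by
  have hfin : volume Ω ≠ ⊤ := hΩ.measure_lt_top.ne
  obtain rfl | hd2 := hd1.eq_or_lt
  -- For d = 1, passing from L¹ to L² for the gradient costs |Ω|^(1/2), and from the sup bound to L⁴
  -- for the function costs |Ω|^(1/4).
  · refine ⟨(volume Ω ^ (1 / 2 : ℝ) * volume Ω ^ (1 / 4 : ℝ)).toNNReal, fun φ hφ => ?_⟩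
    have h1 : eLpNorm (fderiv ℝ φ) 1 volume ≤
        eLpNorm (gradient φ) 2 (vol Ω) * volume Ω ^ (1 / 2 : ℝ) := by
      have := hφ.eLpNorm_fderiv_le (p := 1) one_le_two
      norm_num at this ⊢
      exact this
    have h2 := eLpNorm_le_of_ae_enorm_bound (p := 4) (μ := vol Ω)
      (.of_forall hφ.enorm_le_eLpNorm_fderiv_one)
    rw [ENNReal.coe_toNNReal (by finiteness)]
    refine h2.trans ?_
    rw [Measure.restrict_apply_univ]
    rw [smul_eq_mul]
    refine (mul_le_mul_left h1 _).trans (le_of_eq ?_)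
    norm_num
    ring
  · have hr : Module.finrank ℝ (E d) = d := by simp
    -- Gagliardo-Nirenberg-Sobolev needs p < d and 1/p - 1/d ≤ 1/4. The case d = 2 forces p < 2 and
    -- d = 3 forces p ≥ 12/7; the exponent 7/4 serves both.
    let K := eLpNormLESNormFDerivOfLeConst ℝ (volume : Measure (E d)) Ω (7 / 4) 4
    refine ⟨K * (volume Ω ^ (1 / (7 / 4 : ℝ) - 1 / 2)).toNNReal, fun φ hφ => ?_⟩
    have h1 : eLpNorm φ 4 volume ≤ K * eLpNorm (fderiv ℝ φ) (7 / 4 : ℝ≥0) volume := by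
      refine eLpNorm_le_eLpNorm_fderiv_of_le (q := 4) volume (hφ.smooth.of_le (by simp))
        ((subset_tsupport φ).trans hφ.support_subset) ?_ ?_ ?_ hΩ
      · rw [← NNReal.coe_le_coe]; norm_num
      · rw [hr, ← NNReal.coe_lt_coe]
        have : (2 : ℝ) ≤ d := by exact_mod_cast hd2
        push_cast
        linarith
      · rw [hr]
        have : (d : ℝ) ≤ 3 := by exact_mod_cast hd3
        have h0 : (0 : ℝ) < d := by exact_mod_cast (by omega : 0 < d)
        have : (3 : ℝ)⁻¹ ≤ (d : ℝ)⁻¹ := inv_anti₀ h0 this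
        push_cast
        linarith
    have h74 : ((7 / 4 : ℝ≥0) : ℝ≥0∞) ≤ 2 := by
      have : (7 / 4 : ℝ≥0) ≤ 2 := by rw [← NNReal.coe_le_coe]; norm_num
      exact_mod_cast this
    refine (eLpNorm_mono_measure φ Measure.restrict_le_self).trans (h1.trans ?_)
    refine (mul_le_mul_right (hφ.eLpNorm_fderiv_le h74) _).trans (le_of_eq ?_)
    rw [ENNReal.coe_mul, ENNReal.coe_toNNReal
      (ENNReal.rpow_ne_top_of_nonneg (by norm_num) hfin)]
    simp only [ENNReal.coe_toReal, NNReal.coe_div, NNReal.coe_ofNat]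
    ring

theorem exists_sobolev_grad (hd1 : 1 ≤ d) (hd3 : d ≤ 3) (hΩ : Bornology.IsBounded Ω) :
    ∃ C : ℝ≥0, ∀ u : H10 Ω, eLpNorm u.toL2 4 (vol Ω) ≤ C * ENNReal.ofReal ‖u.grad‖ := by
  obtain ⟨C, hC⟩ := exists_sobolev_testFunction hd1 hd3 hΩ
  refine ⟨C, fun u => ?_⟩
  obtain ⟨U, hU, hlim⟩ := mem_closure_iff_seq_limit.1 u.2
  have hfst : Tendsto (fun n => (U n).fst) atTop (𝓝 u.toL2) :=
    ((by fun_prop : Continuous fun V : PairSpace Ω => V.fst).tendsto _).comp hlim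
  have hsnd : Tendsto (fun n => (U n).snd) atTop (𝓝 u.grad) :=
    ((by fun_prop : Continuous fun V : PairSpace Ω => V.snd).tendsto _).comp hlim
  -- L² convergence gives a subsequence converging almost everywhere, which makes the L⁴ norm lower
  -- semicontinuous along it by Fatou.
  obtain ⟨ns, hns, hae⟩ := (tendstoInMeasure_of_tendsto_Lp hfst).exists_seq_tendsto_ae
  have hbd : ∀ n, eLpNorm (U n).fst 4 (vol Ω) ≤ C * ENNReal.ofReal ‖(U n).snd‖ := by
    intro n
    obtain ⟨φ, hφ, h1, h2⟩ := hU n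
    rw [eLpNorm_congr_ae h1, Lp.norm_def, ENNReal.ofReal_toReal (Lp.eLpNorm_ne_top _),
      eLpNorm_congr_ae h2]
    exact hC φ hφ
  have hlim2 : Tendsto (fun n => C * ENNReal.ofReal ‖(U (ns n)).snd‖) atTop
      (𝓝 (C * ENNReal.ofReal ‖u.grad‖)) :=
    ENNReal.Tendsto.const_mul
      (ENNReal.tendsto_ofReal (hsnd.comp hns.tendsto_atTop).norm) (Or.inr (by finiteness))
  calc eLpNorm u.toL2 4 (vol Ω)
      ≤ atTop.liminf fun n => eLpNorm (U (ns n)).fst 4 (vol Ω) :=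
        Lp.eLpNorm_lim_le_liminf_eLpNorm (fun n => Lp.aestronglyMeasurable _) _ hae
    _ ≤ atTop.liminf fun n => C * ENNReal.ofReal ‖(U (ns n)).snd‖ :=
        liminf_le_liminf (.of_forall fun n => hbd _)
    _ = C * ENNReal.ofReal ‖u.grad‖ := hlim2.liminf_eq

theorem H10.norm_sq (u : H10 Ω) : ‖u‖ ^ 2 = ‖u.toL2‖ ^ 2 + ‖u.grad‖ ^ 2 :=
  WithLp.prod_norm_sq_eq_of_L2 u.1

theorem H10.norm_grad_le (u : H10 Ω) : ‖u.grad‖ ≤ ‖u‖ := by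
  have := u.norm_sq
  exact abs_le_of_sq_le_sq' (by nlinarith [sq_nonneg ‖u.toL2‖]) (norm_nonneg _) |>.2

theorem exists_isSobolevConstant (hd1 : 1 ≤ d) (hd3 : d ≤ 3) (hΩ : Bornology.IsBounded Ω) :
    ∃ C, IsSobolevConstant Ω C := by
  obtain ⟨C, hC⟩ := exists_sobolev_grad hd1 hd3 hΩ
  -- `C` may be zero, whereas the constant must be positive.
  refine ⟨C + 1, by positivity, fun u => (hC u).trans ?_⟩
  rw [← ENNReal.ofReal_coe_nnreal, ← ENNReal.ofReal_mul C.coe_nonneg]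
  refine ENNReal.ofReal_le_ofReal ?_
  gcongr
  · simp
  · exact u.norm_grad_le

theorem exists_isPoincareConstant (hd1 : 1 ≤ d) (hd3 : d ≤ 3) (hΩ : Bornology.IsBounded Ω) :
    ∃ C, IsPoincareConstant Ω C := by
  obtain ⟨C, hC⟩ := exists_sobolev_grad hd1 hd3 hΩ
  have hfin : volume Ω ≠ ⊤ := hΩ.measure_lt_top.ne
  refine ⟨(C * volume Ω ^ (1 / 4 : ℝ)).toReal + 1, by positivity, fun u => ?_⟩
  -- Hölder from L² to L⁴ on Ω costs |Ω|^(1/2 - 1/4), and the L⁴ norm is already controlled by the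
  -- gradient alone.
  have h := (eLpNorm_le_eLpNorm_mul_rpow_measure_univ (p := 2) (q := 4) (by norm_num)
    (Lp.aestronglyMeasurable u.toL2)).trans (mul_le_mul_left (hC u) _)
  rw [Measure.restrict_apply_univ, show 1 / (2 : ℝ≥0∞).toReal - 1 / (4 : ℝ≥0∞).toReal = 1 / 4 by
    norm_num] at h
  have h2 : ‖u.toL2‖ ≤ (C * volume Ω ^ (1 / 4 : ℝ)).toReal * ‖u.grad‖ := by
    rw [Lp.norm_def]
    have := ENNReal.toReal_mono (by finiteness) h
    refine this.trans (le_of_eq ?_)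
    rw [ENNReal.toReal_mul, ENNReal.toReal_mul, ENNReal.toReal_mul,
      ENNReal.toReal_ofReal (norm_nonneg _)]
    ring
  linarith [norm_nonneg u.grad]

end NonlinearDiffusion

end

/-! ### The quartic, diffusion and load forms as bounded multilinear maps -/

noncomputable section

namespace NonlinearDiffusion

open Filter Topology NNReal

variable {d : ℕ} {Ω : Set (E d)}

instance : Fact ((1 : ℝ≥0∞) ≤ 4) := ⟨by norm_num⟩

instance : ENNReal.HolderTriple 4 4 2 where
  inv_add_inv_eq_inv := by
    rw [← two_mul, show (4 : ℝ≥0∞) = 2 * 2 by norm_num, ENNReal.mul_inv (by simp) (by simp),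
      ← mul_assoc, ENNReal.mul_inv_cancel (by simp) (by simp), one_mul]

theorem IsSobolevConstant.memLp_four {C : ℝ} (hC : IsSobolevConstant Ω C) (u : H10 Ω) :
    MemLp u.toL2 4 (vol Ω) :=
  ⟨Lp.aestronglyMeasurable _, (hC.2 u).trans_lt ENNReal.ofReal_lt_top⟩

theorem H10.toL2_add (u v : H10 Ω) : (u + v).toL2 = u.toL2 + v.toL2 := rfl

theorem H10.toL2_smul (c : ℝ) (u : H10 Ω) : (c • u).toL2 = c • u.toL2 := rfl

/-- The embedding `H¹₀(Ω) ↪ L⁴(Ω)`. -/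
def toL4 {C : ℝ} (hC : IsSobolevConstant Ω C) : H10 Ω →L[ℝ] Lp ℝ 4 (vol Ω) :=
  LinearMap.mkContinuous
    { toFun := fun u => (hC.memLp_four u).toLp _
      map_add' := fun u v => by
        rw [← MemLp.toLp_add]
        refine MemLp.toLp_congr _ _ ?_
        rw [H10.toL2_add]
        exact Lp.coeFn_add _ _
      map_smul' := fun c u => by
        rw [RingHom.id_apply, ← MemLp.toLp_const_smul]
        refine MemLp.toLp_congr _ _ ?_
        rw [H10.toL2_smul]
        exact Lp.coeFn_smul _ _ } C fun u => by
    simp only [LinearMap.coe_mk, AddHom.coe_mk, Lp.norm_toLp]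
    exact ENNReal.toReal_le_of_le_ofReal (mul_nonneg hC.1.le (norm_nonneg _)) (hC.2 u)

theorem coeFn_toL4 {C : ℝ} (hC : IsSobolevConstant Ω C) (u : H10 Ω) :
    toL4 hC u =ᵐ[vol Ω] u.toL2 :=
  MemLp.coeFn_toLp (hC.memLp_four u)

/-- The constant `C` serves only to construct the map; its values do not depend on it. Hence the
estimates hold with any other admissible constant `C'`, as the final bounds require. -/
theorem norm_toL4_le {C C' : ℝ} (hC : IsSobolevConstant Ω C) (hC' : IsSobolevConstant Ω C')
    (u : H10 Ω) : ‖toL4 hC u‖ ≤ C' * ‖u‖ := by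
  rw [Lp.norm_def, eLpNorm_congr_ae (coeFn_toL4 hC u)]
  exact ENNReal.toReal_le_of_le_ofReal (mul_nonneg hC'.1.le (norm_nonneg _)) (hC'.2 u)

/-- The product `H¹₀(Ω) × H¹₀(Ω) → L²(Ω)`. -/
def mulL2 {C : ℝ} (hC : IsSobolevConstant Ω C) : H10 Ω →L[ℝ] H10 Ω →L[ℝ] Lp ℝ 2 (vol Ω) :=
  ((ContinuousLinearMap.mul ℝ ℝ).holderL (vol Ω) 4 4 2).bilinearComp (toL4 hC) (toL4 hC)

theorem coeFn_mulL2 {C : ℝ} (hC : IsSobolevConstant Ω C) (u v : H10 Ω) :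
    mulL2 hC u v =ᵐ[vol Ω] fun x => u.toL2 x * v.toL2 x := by
  refine ((ContinuousLinearMap.mul ℝ ℝ).coeFn_holder (toL4 hC u) (toL4 hC v)).trans ?_
  filter_upwards [coeFn_toL4 hC u, coeFn_toL4 hC v] with x h1 h2
  simp [h1, h2]

theorem norm_mulL2_le {C C' : ℝ} (hC : IsSobolevConstant Ω C) (hC' : IsSobolevConstant Ω C')
    (u v : H10 Ω) : ‖mulL2 hC u v‖ ≤ C' ^ 2 * ‖u‖ * ‖v‖ := by
  have h := (ContinuousLinearMap.mul ℝ ℝ).norm_holder_apply_apply_le (r := 2)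
    (toL4 hC u) (toL4 hC v)
  rw [ContinuousLinearMap.opNorm_mul, one_mul] at h
  have h0 := hC'.1.le
  calc ‖mulL2 hC u v‖ ≤ ‖toL4 hC u‖ * ‖toL4 hC v‖ := h
    _ ≤ (C' * ‖u‖) * (C' * ‖v‖) := by
      gcongr <;> exact norm_toL4_le hC hC' _
    _ = C' ^ 2 * ‖u‖ * ‖v‖ := by ring

/-- The form `(u, p, q, v) ↦ ⟪B u p, B q v⟫` of a bilinear map `B`. -/
def innerForm {V H : Type*} [NormedAddCommGroup V] [NormedSpace ℝ V] [NormedAddCommGroup H]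
    [InnerProductSpace ℝ H] (B : V →L[ℝ] V →L[ℝ] H) :
    V →L[ℝ] V →L[ℝ] V →L[ℝ] StrongDual ℝ V :=
  -- `G h` is (q, v) ↦ ⟪h, B q v⟫. Building the form from compositions makes its continuity in all
  -- arguments automatic.
  let G : H →L[ℝ] V →L[ℝ] StrongDual ℝ V :=
    ((ContinuousLinearMap.compL ℝ V (V →L[ℝ] H) (V →L[ℝ] ℝ)).flip B) ∘L
      (ContinuousLinearMap.compL ℝ V H ℝ) ∘L (innerSL ℝ)
  (ContinuousLinearMap.compL ℝ V H (V →L[ℝ] StrongDual ℝ V) G) ∘L B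

theorem innerForm_apply {V H : Type*} [NormedAddCommGroup V] [NormedSpace ℝ V]
    [NormedAddCommGroup H] [InnerProductSpace ℝ H] (B : V →L[ℝ] V →L[ℝ] H) (u p q v : V) :
    innerForm B u p q v = inner ℝ (B u p) (B q v) := rfl

/-- The form `(u, p, q, v) ↦ ∫ u p q v`. -/
def quarticForm {C : ℝ} (hC : IsSobolevConstant Ω C) :
    H10 Ω →L[ℝ] H10 Ω →L[ℝ] H10 Ω →L[ℝ] DualH10 Ω :=
  innerForm (mulL2 hC)

theorem quarticForm_eq_inner {C : ℝ} (hC : IsSobolevConstant Ω C) (u p q v : H10 Ω) :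
    quarticForm hC u p q v = inner ℝ (mulL2 hC u p) (mulL2 hC q v) :=
  innerForm_apply _ u p q v

theorem inner_mulL2_ae {C : ℝ} (hC : IsSobolevConstant Ω C) (u p q v : H10 Ω) :
    (fun x => inner ℝ (mulL2 hC u p x) (mulL2 hC q v x)) =ᵐ[vol Ω]
      fun x => u.toL2 x * p.toL2 x * q.toL2 x * v.toL2 x := by
  filter_upwards [coeFn_mulL2 hC u p, coeFn_mulL2 hC q v] with x h1 h2
  rw [h1, h2]
  simp
  ring

theorem integrable_quartic {C : ℝ} (hC : IsSobolevConstant Ω C) (u p q v : H10 Ω) :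
    Integrable (fun x => u.toL2 x * p.toL2 x * q.toL2 x * v.toL2 x) (vol Ω) :=
  (L2.integrable_inner (𝕜 := ℝ) (mulL2 hC u p) (mulL2 hC q v)).congr (inner_mulL2_ae hC u p q v)

theorem quarticForm_apply {C : ℝ} (hC : IsSobolevConstant Ω C) (u p q v : H10 Ω) :
    quarticForm hC u p q v = ∫ x in Ω, u.toL2 x * p.toL2 x * q.toL2 x * v.toL2 x := by
  rw [quarticForm_eq_inner, L2.inner_def]
  exact integral_congr_ae (inner_mulL2_ae hC u p q v)

theorem quarticForm_swap_left {C : ℝ} (hC : IsSobolevConstant Ω C) (u p q : H10 Ω) :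
    quarticForm hC u p q = quarticForm hC p u q := by
  ext v
  simp only [quarticForm_apply]
  congr 1
  ext x
  ring

theorem quarticForm_swap_right {C : ℝ} (hC : IsSobolevConstant Ω C) (u p q : H10 Ω) :
    quarticForm hC u p q = quarticForm hC u q p := by
  ext v
  simp only [quarticForm_apply]
  congr 1
  ext x
  ring

theorem norm_quarticForm_le {C C' : ℝ} (hC : IsSobolevConstant Ω C)
    (hC' : IsSobolevConstant Ω C') (u p q : H10 Ω) :
    ‖quarticForm hC u p q‖ ≤ C' ^ 4 * ‖u‖ * ‖p‖ * ‖q‖ := by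
  refine ContinuousLinearMap.opNorm_le_bound _ (by positivity) fun v => ?_
  rw [quarticForm_eq_inner]
  calc ‖inner ℝ (mulL2 hC u p) (mulL2 hC q v)‖
      ≤ ‖mulL2 hC u p‖ * ‖mulL2 hC q v‖ := norm_inner_le_norm _ _
    _ ≤ (C' ^ 2 * ‖u‖ * ‖p‖) * (C' ^ 2 * ‖q‖ * ‖v‖) := by
      gcongr <;> exact norm_mulL2_le hC hC' _ _
    _ = C' ^ 4 * ‖u‖ * ‖p‖ * ‖q‖ * ‖v‖ := by ring

theorem quarticForm_nonneg {C : ℝ} (hC : IsSobolevConstant Ω C) (u v : H10 Ω) :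
    0 ≤ quarticForm hC u u v v := by
  -- Swapping the middle arguments turns ⟪u u, v v⟫ into ⟪u v, u v⟫, a square.
  rw [quarticForm_swap_right, quarticForm_eq_inner]
  exact real_inner_self_nonneg

/-- The weak gradient as a continuous linear map. -/
def gradL : H10 Ω →L[ℝ] Lp (E d) 2 (vol Ω) :=
  LinearMap.mkContinuous
    { toFun := H10.grad
      map_add' := fun _ _ => rfl
      map_smul' := fun _ _ => rfl } 1 fun u => by
    rw [one_mul]
    exact u.norm_grad_le

/-- Multiplication by `m ∈ L^∞(Ω)` on `L²(Ω; ℝᵈ)`. -/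
def mulGrad (m : Lp ℝ ∞ (vol Ω)) : Lp (E d) 2 (vol Ω) →L[ℝ] Lp (E d) 2 (vol Ω) :=
  (ContinuousLinearMap.lsmul ℝ ℝ).holderL (vol Ω) ⊤ 2 2 m

theorem coeFn_mulGrad (m : Lp ℝ ∞ (vol Ω)) (g : Lp (E d) 2 (vol Ω)) :
    mulGrad m g =ᵐ[vol Ω] fun x => m x • g x :=
  (ContinuousLinearMap.lsmul ℝ ℝ).coeFn_holder m g

theorem norm_mulGrad_le (m : Lp ℝ ∞ (vol Ω)) (g : Lp (E d) 2 (vol Ω)) :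
    ‖mulGrad m g‖ ≤ ‖m‖ * ‖g‖ := by
  refine ((ContinuousLinearMap.lsmul ℝ ℝ).norm_holder_apply_apply_le (r := 2) m g).trans ?_
  gcongr
  exact mul_le_of_le_one_left (norm_nonneg _) ContinuousLinearMap.opNorm_lsmul_le

/-- The form `(u, v) ↦ ∫ m ∇u·∇v`. -/
def diffusionForm (m : Lp ℝ ∞ (vol Ω)) : H10 Ω →L[ℝ] DualH10 Ω :=
  ContinuousLinearMap.bilinearComp (innerSL ℝ) (mulGrad m ∘L gradL) gradL

theorem diffusionForm_eq_inner (m : Lp ℝ ∞ (vol Ω)) (u v : H10 Ω) :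
    diffusionForm m u v = inner ℝ (mulGrad m u.grad) v.grad := rfl

theorem inner_mulGrad_ae (m : Lp ℝ ∞ (vol Ω)) (g h : Lp (E d) 2 (vol Ω)) :
    (fun x => inner ℝ (mulGrad m g x) (h x)) =ᵐ[vol Ω] fun x => m x * inner ℝ (g x) (h x) := by
  filter_upwards [coeFn_mulGrad m g] with x hx
  rw [hx, real_inner_smul_left]

theorem integrable_diffusion (m : Lp ℝ ∞ (vol Ω)) (u v : H10 Ω) :
    Integrable (fun x => m x * inner ℝ (u.grad x) (v.grad x)) (vol Ω) :=
  (L2.integrable_inner (𝕜 := ℝ) (mulGrad m u.grad) v.grad).congr (inner_mulGrad_ae m _ _)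

theorem diffusionForm_apply (m : Lp ℝ ∞ (vol Ω)) (u v : H10 Ω) :
    diffusionForm m u v = ∫ x in Ω, m x * inner ℝ (u.grad x) (v.grad x) := by
  rw [diffusionForm_eq_inner, L2.inner_def]
  exact integral_congr_ae (inner_mulGrad_ae m _ _)

theorem norm_diffusionForm_le (m : Lp ℝ ∞ (vol Ω)) (u : H10 Ω) :
    ‖diffusionForm m u‖ ≤ ‖m‖ * ‖u‖ := by
  refine ContinuousLinearMap.opNorm_le_bound _ (by positivity) fun v => ?_
  rw [diffusionForm_eq_inner]
  calc ‖inner ℝ (mulGrad m u.grad) v.grad‖ ≤ ‖mulGrad m u.grad‖ * ‖v.grad‖ :=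
        norm_inner_le_norm _ _
    _ ≤ (‖m‖ * ‖u‖) * ‖v‖ := by
      gcongr
      · refine (norm_mulGrad_le m _).trans ?_
        gcongr
        exact u.norm_grad_le
      · exact v.norm_grad_le

theorem le_diffusionForm {m : Lp ℝ ∞ (vol Ω)} {c : ℝ} (hm : ∀ᵐ x ∂(vol Ω), c ≤ m x)
    (v : H10 Ω) : c * ‖v.grad‖ ^ 2 ≤ diffusionForm m v v := by
  rw [diffusionForm_apply, ← real_inner_self_eq_norm_sq, L2.inner_def, ← integral_const_mul]
  refine integral_mono_ae ((L2.integrable_inner (𝕜 := ℝ) v.grad v.grad).const_mul c)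
    (integrable_diffusion m v v) ?_
  filter_upwards [hm] with x hx
  exact mul_le_mul_of_nonneg_right hx real_inner_self_nonneg

/-- The functional `v ↦ ∫ f v`. -/
def load (f : Lp ℝ 2 (vol Ω)) : DualH10 Ω :=
  (innerSL ℝ f) ∘L (WithLp.fstL 2 ℝ (Lp ℝ 2 (vol Ω)) (Lp (E d) 2 (vol Ω))) ∘L
    (testPairs Ω).topologicalClosure.subtypeL

theorem load_eq_inner (f : Lp ℝ 2 (vol Ω)) (v : H10 Ω) : load f v = inner ℝ f v.toL2 := rfl

theorem inner_load_ae (f g : Lp ℝ 2 (vol Ω)) :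
    (fun x => inner ℝ (f x) (g x)) =ᵐ[vol Ω] fun x => f x * g x :=
  .of_forall fun x => by simp [mul_comm]

theorem integrable_load (f : Lp ℝ 2 (vol Ω)) (v : H10 Ω) :
    Integrable (fun x => f x * v.toL2 x) (vol Ω) :=
  (L2.integrable_inner (𝕜 := ℝ) f v.toL2).congr (inner_load_ae f _)

theorem load_apply (f : Lp ℝ 2 (vol Ω)) (v : H10 Ω) :
    load f v = ∫ x in Ω, f x * v.toL2 x := by
  rw [load_eq_inner, L2.inner_def]
  exact integral_congr_ae (inner_load_ae f _)

end NonlinearDiffusion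

end

/-! ### Gâteaux derivatives and bounds for abstract cubic maps -/

noncomputable section

namespace NonlinearDiffusion

open Filter Topology NNReal

section Abstract

variable {V W : Type*} [NormedAddCommGroup V] [NormedSpace ℝ V] [NormedAddCommGroup W]
  [NormedSpace ℝ W]

theorem hasDerivAt_cubic_zero (a b c e : W) :
    HasDerivAt (fun t : ℝ => a + t • b + t ^ 2 • c + t ^ 3 • e) b 0 := by
  have h1 := (hasDerivAt_id (0 : ℝ)).smul_const b
  have h2 := (hasDerivAt_pow 2 (0 : ℝ)).smul_const c
  have h3 := (hasDerivAt_pow 3 (0 : ℝ)).smul_const e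
  have h := ((h1.const_add a).add h2).add h3
  simp only [one_smul, Nat.cast_ofNat, Nat.add_one_sub_one, ne_eq, OfNat.ofNat_ne_zero,
    not_false_eq_true, zero_pow, mul_zero, zero_smul, add_zero, pow_one] at h
  exact h

/-- The map `u ↦ κ K u + α T(u, u, u) - F`. -/
def cubicMap (κ α : ℝ) (K : V →L[ℝ] W) (T : V →L[ℝ] V →L[ℝ] V →L[ℝ] W) (F : W) (u : V) : W :=
  κ • K u + α • T u u u - F

/-- The derivative `p ↦ κ K p + 3 α T(u, u, p)` of `cubicMap`, for symmetric `T`. -/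
def cubicMapDeriv (κ α : ℝ) (K : V →L[ℝ] W) (T : V →L[ℝ] V →L[ℝ] V →L[ℝ] W) (u : V) :
    V →L[ℝ] W :=
  κ • K + (3 * α) • T u u

/-- The second derivative `(p, q) ↦ 6 α T(u, p, q)` of `cubicMap`, for symmetric `T`. -/
def cubicMapDeriv₂ (α : ℝ) (T : V →L[ℝ] V →L[ℝ] V →L[ℝ] W) (u : V) : V →L[ℝ] V →L[ℝ] W :=
  (6 * α) • T u

variable (κ α : ℝ) (K : V →L[ℝ] W) (T : V →L[ℝ] V →L[ℝ] V →L[ℝ] W) (F : W)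

theorem cubicMapDeriv_apply (u p : V) :
    cubicMapDeriv κ α K T u p = κ • K p + (3 * α) • T u u p := rfl

theorem cubicMapDeriv₂_apply (u p q : V) :
    cubicMapDeriv₂ α T u p q = (6 * α) • T u p q := rfl

theorem cubicMap_apply_dual {V : Type*} [NormedAddCommGroup V] [NormedSpace ℝ V] (κ α : ℝ)
    (K : V →L[ℝ] StrongDual ℝ V) (T : V →L[ℝ] V →L[ℝ] V →L[ℝ] StrongDual ℝ V)
    (F : StrongDual ℝ V) (u v : V) :
    cubicMap κ α K T F u v = κ * K u v + α * T u u u v - F v := rfl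

theorem cubicMapDeriv_apply_dual {V : Type*} [NormedAddCommGroup V] [NormedSpace ℝ V] (κ α : ℝ)
    (K : V →L[ℝ] StrongDual ℝ V) (T : V →L[ℝ] V →L[ℝ] V →L[ℝ] StrongDual ℝ V) (u p v : V) :
    cubicMapDeriv κ α K T u p v = κ * K p v + 3 * α * T u u p v := rfl

theorem cubicMapDeriv₂_apply_dual {V : Type*} [NormedAddCommGroup V] [NormedSpace ℝ V] (α : ℝ)
    (T : V →L[ℝ] V →L[ℝ] V →L[ℝ] StrongDual ℝ V) (u p q v : V) :
    cubicMapDeriv₂ α T u p q v = 6 * α * T u p q v := rfl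

variable {T}

/-- The two transpositions generate all permutations of the arguments, so the mixed terms of T(u +
tp, u + tp, u + tp) merge into binomial coefficients, and the coefficient of t is the derivative. -/
theorem hasLineDerivAt_cubicMap (hl : ∀ u p q, T u p q = T p u q)
    (hr : ∀ u p q, T u p q = T u q p) (u p : V) :
    HasLineDerivAt ℝ (cubicMap κ α K T F) (cubicMapDeriv κ α K T u p) u p := by
  have h := hasDerivAt_cubic_zero (κ • K u + α • T u u u - F) (κ • K p + (3 * α) • T u u p)
    ((3 * α) • T u p p) (α • T p p p)
  refine h.congr_of_eventuallyEq (.of_forall fun t => ?_)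
  have e1 : T u p u = T u u p := hr _ _ _
  have e2 : T p u u = T u u p := by rw [hl, hr]
  have e3 : T p u p = T u p p := hl _ _ _
  have e4 : T p p u = T u p p := by rw [hr, hl]
  simp only [cubicMap, map_add, map_smul, add_apply, smul_apply, e1, e2, e3, e4]
  module

theorem hasLineDerivAt_cubicMapDeriv (hl : ∀ u p q, T u p q = T p u q)
    (hr : ∀ u p q, T u p q = T u q p) (u p q : V) :
    HasLineDerivAt ℝ (fun w => cubicMapDeriv κ α K T w p) (cubicMapDeriv₂ α T u p q) u q := by
  have h := hasDerivAt_cubic_zero (κ • K p + (3 * α) • T u u p) ((6 * α) • T u p q)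
    -- The derivative is only quadratic along the line, so the cubic coefficient is zero.
    ((3 * α) • T q q p) 0
  refine h.congr_of_eventuallyEq (.of_forall fun t => ?_)
  have e1 : T u q p = T u p q := hr _ _ _
  have e2 : T q u p = T u p q := by rw [hl, hr]
  simp only [cubicMapDeriv_apply, map_add, map_smul, add_apply, smul_apply, e1, e2]
  module

variable {κ α K}

theorem norm_cubicMapDeriv_apply_le (hκ : 0 ≤ κ) (hα : 0 ≤ α) {a c : ℝ}
    (hK : ∀ v, ‖K v‖ ≤ a * ‖v‖) (hT : ∀ u p q, ‖T u p q‖ ≤ c * ‖u‖ * ‖p‖ * ‖q‖) (u v : V) :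
    ‖cubicMapDeriv κ α K T u v‖ ≤ (κ * a + 3 * α * c * ‖u‖ ^ 2) * ‖v‖ := by
  rw [cubicMapDeriv_apply]
  refine (norm_add_le _ _).trans ?_
  rw [norm_smul, norm_smul, Real.norm_of_nonneg hκ,
    Real.norm_of_nonneg (by positivity : 0 ≤ 3 * α)]
  calc κ * ‖K v‖ + 3 * α * ‖T u u v‖ ≤ κ * (a * ‖v‖) + 3 * α * (c * ‖u‖ * ‖u‖ * ‖v‖) := by
        gcongr
        · exact hK v
        · exact hT u u v
    _ = (κ * a + 3 * α * c * ‖u‖ ^ 2) * ‖v‖ := by ring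

theorem norm_cubicMapDeriv_le (hκ : 0 ≤ κ) (hα : 0 ≤ α) {a c : ℝ} (ha : 0 ≤ a) (hc : 0 ≤ c)
    (hK : ∀ v, ‖K v‖ ≤ a * ‖v‖) (hT : ∀ u p q, ‖T u p q‖ ≤ c * ‖u‖ * ‖p‖ * ‖q‖) (u : V) :
    ‖cubicMapDeriv κ α K T u‖ ≤ κ * a + 3 * α * c * ‖u‖ ^ 2 :=
  ContinuousLinearMap.opNorm_le_bound _ (by positivity)
    (norm_cubicMapDeriv_apply_le hκ hα hK hT u)

theorem norm_cubicMapDeriv₂_apply_le (hα : 0 ≤ α) {c : ℝ}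
    (hT : ∀ u p q, ‖T u p q‖ ≤ c * ‖u‖ * ‖p‖ * ‖q‖) (u p q : V) :
    ‖cubicMapDeriv₂ α T u p q‖ ≤ 6 * α * c * ‖u‖ * ‖p‖ * ‖q‖ := by
  rw [cubicMapDeriv₂_apply, norm_smul, Real.norm_of_nonneg (by positivity : 0 ≤ 6 * α)]
  calc 6 * α * ‖T u p q‖ ≤ 6 * α * (c * ‖u‖ * ‖p‖ * ‖q‖) := by
        gcongr
        exact hT u p q
    _ = 6 * α * c * ‖u‖ * ‖p‖ * ‖q‖ := by ring

theorem norm_cubicMapDeriv₂_le (hα : 0 ≤ α) {c : ℝ} (hc : 0 ≤ c)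
    (hT : ∀ u p q, ‖T u p q‖ ≤ c * ‖u‖ * ‖p‖ * ‖q‖) (u : V) :
    ‖cubicMapDeriv₂ α T u‖ ≤ 6 * α * c * ‖u‖ :=
  ContinuousLinearMap.opNorm_le_bound _ (by positivity) fun p =>
    ContinuousLinearMap.opNorm_le_bound _ (by positivity)
      (norm_cubicMapDeriv₂_apply_le hα hT u p)

end Abstract

theorem integral_combination {X : Type*} [MeasurableSpace X] {μ : Measure X} {g h F : X → ℝ}
    {a b c e : ℝ} (hg : Integrable g μ) (hh : Integrable h μ) (ha : a = ∫ x, g x ∂μ)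
    (hb : b = ∫ x, h x ∂μ) (hF : ∀ x, F x = c * g x + e * h x) :
    Integrable F μ ∧ c * a + e * b = ∫ x, F x ∂μ := by
  obtain rfl : F = fun x => c * g x + e * h x := funext hF
  refine ⟨(hg.const_mul c).add (hh.const_mul e), ?_⟩
  rw [integral_add (hg.const_mul c) (hh.const_mul e), integral_const_mul, integral_const_mul,
    ha, hb]

/-! ### Coercive operators into the dual -/

section LaxMilgram

variable {V : Type*} [NormedAddCommGroup V] [InnerProductSpace ℝ V]
  {A : V →L[ℝ] StrongDual ℝ V} {c : ℝ}

theorem le_norm_apply_of_coercive (hA : ∀ v, c * ‖v‖ ^ 2 ≤ A v v) (v : V) :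
    c * ‖v‖ ≤ ‖A v‖ := by
  obtain h | h := (norm_nonneg v).eq_or_lt
  · simp [← h]
  · have h1 := (hA v).trans ((le_abs_self _).trans ((A v).le_opNorm v))
    exact le_of_mul_le_mul_right (by linarith) h

theorem le_norm_of_coercive [Nontrivial V] (hA : ∀ v, c * ‖v‖ ^ 2 ≤ A v v) : c ≤ ‖A‖ := by
  obtain ⟨v, hv⟩ := exists_ne (0 : V)
  exact le_of_mul_le_mul_right
    ((le_norm_apply_of_coercive hA v).trans (A.le_opNorm v)) (norm_pos_iff.2 hv)

/-- The **Lax-Milgram theorem**, with a bound on the inverse. -/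
theorem exists_equiv_of_coercive [CompleteSpace V] (hc : 0 < c)
    (hA : ∀ v, c * ‖v‖ ^ 2 ≤ A v v) :
    ∃ e : V ≃L[ℝ] StrongDual ℝ V, (e : V →L[ℝ] StrongDual ℝ V) = A ∧
      ‖(e.symm : StrongDual ℝ V →L[ℝ] V)‖ ≤ 1 / c := by
  have hcoer : IsCoercive A := ⟨c, hc, fun v => by simpa [sq, mul_assoc] using hA v⟩
  have hbd := le_norm_apply_of_coercive hA
  -- The lower bound c‖v‖ ≤ ‖A v‖ forces a trivial kernel.
  have hinj : A.ker = ⊥ := by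
    refine LinearMap.ker_eq_bot'.2 fun v hv => ?_
    have h := hbd v
    rw [show A v = 0 from hv, norm_zero] at h
    exact norm_le_zero_iff.1 (by nlinarith [norm_nonneg v])
  have hsurj : A.range = ⊤ := by
    refine LinearMap.range_eq_top.2 fun l => ?_
    -- Lax-Milgram provides an automorphism of V representing `A` through the inner product; the
    -- preimage of `l` is its inverse applied to the Riesz representative of `l`.
    refine ⟨hcoer.continuousLinearEquivOfBilin.symm ((InnerProductSpace.toDual ℝ V).symm l), ?_⟩
    ext w
    have := hcoer.continuousLinearEquivOfBilin_apply
      (hcoer.continuousLinearEquivOfBilin.symm ((InnerProductSpace.toDual ℝ V).symm l)) w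
    rw [ContinuousLinearEquiv.apply_symm_apply, InnerProductSpace.toDual_symm_apply] at this
    exact this.symm
  refine ⟨ContinuousLinearEquiv.ofBijective A hinj hsurj, ?_, ?_⟩
  · ext1 v
    simp
  · refine ContinuousLinearMap.opNorm_le_bound _ (by positivity) fun l => ?_
    -- The lower bound at the preimage of `l` is the bound on the inverse.
    have h := hbd ((ContinuousLinearEquiv.ofBijective A hinj hsurj).symm l)
    rw [ContinuousLinearEquiv.ofBijective_apply_symm_apply] at h
    rw [one_div, ContinuousLinearEquiv.coe_coe, le_inv_mul_iff₀ hc]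
    exact h

end LaxMilgram

/-! ### Coercivity and derivatives of the residual -/

variable {d : ℕ} {Ω : Set (E d)}

/-- The lower bound on the operator norm needs a nonzero vector: a bump function equal to 1 at a
point of Ω. By continuity it cannot vanish almost everywhere on the open set Ω. -/
theorem nontrivial_H10 (hΩ : IsOpen Ω) (hne : Ω.Nonempty) : Nontrivial (H10 Ω) := by
  obtain ⟨x, hx⟩ := hne
  obtain ⟨φ, h1, h2, h3, -, h5⟩ := exists_contDiff_tsupport_subset (n := ⊤) (hΩ.mem_nhds hx)
  have hφ : IsTestFunction Ω φ := ⟨h3, h2, h1⟩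
  have hM1 : MemLp φ 2 (vol Ω) := (h3.continuous.memLp_of_hasCompactSupport h2).restrict Ω
  have hgc : Continuous (gradient φ) :=
    (InnerProductSpace.toDual ℝ (E d)).symm.continuous.comp (h3.continuous_fderiv (by simp))
  have hgs : HasCompactSupport (gradient φ) := (h2.fderiv ℝ).comp_left (map_zero _)
  have hM2 : MemLp (gradient φ) 2 (vol Ω) := (hgc.memLp_of_hasCompactSupport hgs).restrict Ω
  let U : PairSpace Ω := WithLp.toLp 2 (hM1.toLp φ, hM2.toLp (gradient φ))
  have hU : U ∈ testPairs Ω := ⟨φ, hφ, hM1.coeFn_toLp, hM2.coeFn_toLp⟩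
  refine ⟨⟨U, (testPairs Ω).le_topologicalClosure hU⟩, 0, fun h => ?_⟩
  have h0 : hM1.toLp φ = 0 := congrArg H10.toL2 h
  have hae : φ =ᵐ[vol Ω] fun _ => 0 :=
    hM1.coeFn_toLp.symm.trans (h0 ▸ Lp.coeFn_zero _ _ _)
  have := Measure.eqOn_open_of_ae_eq hae hΩ h3.continuous.continuousOn continuousOn_const hx
  simp [h5] at this

/-- With μ = min{1, C_P⁻²}, both μ‖v‖²_{L²} (by Poincaré) and μ‖∇v‖² are at most ‖∇v‖². Their sum is
at most 2‖∇v‖², whence the factor 1/2 in `lowerConst`. -/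
theorem lowerConst_mul_norm_sq_le {κ₀ mlw CP : ℝ} (hκ₀ : 0 < κ₀) (hmlw : 0 < mlw)
    (hCP : IsPoincareConstant Ω CP) (v : H10 Ω) :
    lowerConst κ₀ mlw CP * ‖v‖ ^ 2 ≤ κ₀ * (mlw * ‖v.grad‖ ^ 2) := by
  have h1 : min 1 ((CP ^ 2)⁻¹) * ‖v.toL2‖ ^ 2 ≤ ‖v.grad‖ ^ 2 := by
    have h2 : ‖v.toL2‖ ^ 2 ≤ CP ^ 2 * ‖v.grad‖ ^ 2 := by
      rw [← mul_pow]
      exact pow_le_pow_left₀ (norm_nonneg _) (hCP.2 v) 2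
    calc min 1 ((CP ^ 2)⁻¹) * ‖v.toL2‖ ^ 2 ≤ (CP ^ 2)⁻¹ * ‖v.toL2‖ ^ 2 := by
          gcongr
          exact min_le_right _ _
      _ ≤ ‖v.grad‖ ^ 2 := by rwa [inv_mul_le_iff₀ (pow_pos hCP.1 2)]
  have h3 : min 1 ((CP ^ 2)⁻¹) * ‖v.grad‖ ^ 2 ≤ ‖v.grad‖ ^ 2 :=
    mul_le_of_le_one_left (sq_nonneg _) (min_le_left _ _)
  rw [lowerConst, v.norm_sq]
  have h4 : min 1 ((CP ^ 2)⁻¹) * (‖v.toL2‖ ^ 2 + ‖v.grad‖ ^ 2) ≤ 2 * ‖v.grad‖ ^ 2 := by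
    linarith
  have h5 := mul_le_mul_of_nonneg_left h4 (by positivity : 0 ≤ κ₀ * mlw / 2)
  linarith

theorem lowerConst_pos {κ₀ mlw CP : ℝ} (hκ₀ : 0 < κ₀) (hmlw : 0 < mlw) (hCP : 0 < CP) :
    0 < lowerConst κ₀ mlw CP := by
  have : 0 < min 1 ((CP ^ 2)⁻¹) := lt_min one_pos (by positivity)
  unfold lowerConst
  positivity

/-- The residual operator, built from the Sobolev embedding. -/
def residual {C : ℝ} (hC : IsSobolevConstant Ω C) (κ₀ α : ℝ) (f : Lp ℝ 2 (vol Ω))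
    (m : Lp ℝ ∞ (vol Ω)) : H10 Ω → DualH10 Ω :=
  cubicMap κ₀ α (diffusionForm m) (quarticForm hC) (load f)

/-- The first derivative of the residual operator. -/
def residualDeriv {C : ℝ} (hC : IsSobolevConstant Ω C) (κ₀ α : ℝ) (m : Lp ℝ ∞ (vol Ω)) :
    H10 Ω → H10 Ω →L[ℝ] DualH10 Ω :=
  cubicMapDeriv κ₀ α (diffusionForm m) (quarticForm hC)

/-- The second derivative of the residual operator. -/
def residualDeriv₂ {C : ℝ} (hC : IsSobolevConstant Ω C) (α : ℝ) :
    H10 Ω → H10 Ω →L[ℝ] H10 Ω →L[ℝ] DualH10 Ω :=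
  cubicMapDeriv₂ α (quarticForm hC)

section Residual

variable {C : ℝ} (hC : IsSobolevConstant Ω C) (κ₀ α : ℝ) (f : Lp ℝ 2 (vol Ω))
  (m : Lp ℝ ∞ (vol Ω))

theorem residual_apply (u v : H10 Ω) : residual hC κ₀ α f m u v =
    κ₀ * diffusionForm m u v + α * quarticForm hC u u u v - load f v :=
  cubicMap_apply_dual κ₀ α (diffusionForm m) (quarticForm hC) (load f) u v

theorem residualDeriv_apply (u p v : H10 Ω) : residualDeriv hC κ₀ α m u p v =
    κ₀ * diffusionForm m p v + 3 * α * quarticForm hC u u p v :=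
  cubicMapDeriv_apply_dual κ₀ α (diffusionForm m) (quarticForm hC) u p v

theorem residualDeriv₂_apply (u p q v : H10 Ω) : residualDeriv₂ hC α u p q v =
    6 * α * quarticForm hC u p q v :=
  cubicMapDeriv₂_apply_dual α (quarticForm hC) u p q v

theorem isResidual_residual : IsResidual κ₀ α f m (residual hC κ₀ α f m) := by
  intro u v
  have h := integral_combination (F := formIntegrand κ₀ α m u v) (c := κ₀) (e := α)
    (integrable_diffusion m u v) (integrable_quartic hC u u u v)
    (diffusionForm_apply m u v) (quarticForm_apply hC u u u v)
    (fun x => by simp only [formIntegrand]; ring)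
  exact ⟨h.1, integrable_load f v,
    (residual_apply hC κ₀ α f m u v).trans (congrArg₂ (· - ·) h.2 (load_apply f v))⟩

theorem isFirstVariation_residual :
    IsFirstVariation (residual hC κ₀ α f m) (residualDeriv hC κ₀ α m) := fun u p =>
  hasLineDerivAt_cubicMap κ₀ α (diffusionForm m) (load f)
    (quarticForm_swap_left hC) (quarticForm_swap_right hC) u p

theorem isSecondVariation_residual :
    IsSecondVariation (residualDeriv hC κ₀ α m) (residualDeriv₂ hC α) := fun u p q =>
  hasLineDerivAt_cubicMapDeriv κ₀ α (diffusionForm m)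
    (quarticForm_swap_left hC) (quarticForm_swap_right hC) u p q

theorem residualDeriv_eq_integral (u p v : H10 Ω) :
    Integrable (firstIntegrand κ₀ α m u p v) (vol Ω) ∧
      residualDeriv hC κ₀ α m u p v = ∫ x in Ω, firstIntegrand κ₀ α m u p v x := by
  have h := integral_combination (F := firstIntegrand κ₀ α m u p v) (c := κ₀) (e := 3 * α)
    (integrable_diffusion m p v) (integrable_quartic hC u u p v)
    (diffusionForm_apply m p v) (quarticForm_apply hC u u p v)
    (fun x => by simp only [firstIntegrand]; ring)
  exact ⟨h.1, (residualDeriv_apply hC κ₀ α m u p v).trans h.2⟩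

theorem residualDeriv₂_eq_integral (u p q v : H10 Ω) :
    Integrable (secondIntegrand α u p q v) (vol Ω) ∧
      residualDeriv₂ hC α u p q v = ∫ x in Ω, secondIntegrand α u p q v x := by
  have hF : secondIntegrand α u p q v =
      fun x => 6 * α * (u.toL2 x * p.toL2 x * q.toL2 x * v.toL2 x) := by
    ext x
    simp only [secondIntegrand]
    ring
  refine ⟨hF ▸ (integrable_quartic hC u p q v).const_mul (6 * α),
    (residualDeriv₂_apply hC α u p q v).trans ?_⟩
  exact (congrArg (6 * α * ·) (quarticForm_apply hC u p q v)).trans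
    ((integral_const_mul _ _).symm.trans (congrArg (fun F => ∫ x in Ω, F x) hF.symm))

variable {κ₀ α m}

theorem residualDeriv_coercive (hκ₀ : 0 < κ₀) (hα : 0 < α) {mlw CP : ℝ} (hmlw : 0 < mlw)
    (hm : ∀ᵐ x ∂(vol Ω), mlw ≤ m x) (hCP : IsPoincareConstant Ω CP) (u v : H10 Ω) :
    lowerConst κ₀ mlw CP * ‖v‖ ^ 2 ≤ residualDeriv hC κ₀ α m u v v := by
  have h1 := lowerConst_mul_norm_sq_le hκ₀ hmlw hCP v
  have h2 := mul_le_mul_of_nonneg_left (le_diffusionForm hm v) hκ₀.le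
  have h3 := mul_nonneg hα.le (quarticForm_nonneg hC u v)
  refine le_of_le_of_eq ?_ (residualDeriv_apply hC κ₀ α m u v v).symm
  linarith

variable {CS : ℝ}

theorem norm_residualDeriv₂_apply_le (hα : 0 < α) (hCS : IsSobolevConstant Ω CS) (u p q : H10 Ω) :
    ‖residualDeriv₂ hC α u p q‖ ≤ secondConst α CS u * ‖p‖ * ‖q‖ :=
  norm_cubicMapDeriv₂_apply_le hα.le (norm_quarticForm_le hC hCS) u p q

theorem norm_residualDeriv₂_le (hα : 0 < α) (hCS : IsSobolevConstant Ω CS) (u : H10 Ω) :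
    ‖residualDeriv₂ hC α u‖ ≤ secondConst α CS u :=
  norm_cubicMapDeriv₂_le hα.le (by positivity) (norm_quarticForm_le hC hCS) u

theorem norm_residualDeriv_apply_le (hκ₀ : 0 < κ₀) (hα : 0 < α)
    (hCS : IsSobolevConstant Ω CS) (u v : H10 Ω) :
    ‖residualDeriv hC κ₀ α m u v‖ ≤ upperConst κ₀ α CS m u * ‖v‖ :=
  norm_cubicMapDeriv_apply_le hκ₀.le hα.le (norm_diffusionForm_le m)
    (norm_quarticForm_le hC hCS) u v

theorem norm_residualDeriv_le (hκ₀ : 0 < κ₀) (hα : 0 < α)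
    (hCS : IsSobolevConstant Ω CS) (u : H10 Ω) :
    ‖residualDeriv hC κ₀ α m u‖ ≤ upperConst κ₀ α CS m u :=
  norm_cubicMapDeriv_le hκ₀.le hα.le (norm_nonneg m) (by positivity) (norm_diffusionForm_le m)
    (norm_quarticForm_le hC hCS) u

end Residual

end NonlinearDiffusion

end

theorem theorem3 {d : ℕ} (hd1 : 1 ≤ d) (hd3 : d ≤ 3)
    (Ω : Set (NonlinearDiffusion.E d)) (hΩ_open : IsOpen Ω)
    (hΩ_bdd : Bornology.IsBounded Ω) (hΩ_ne : Ω.Nonempty)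
    (κ₀ α mlw : ℝ) (hκ₀ : 0 < κ₀) (hα : 0 < α) (hmlw : 0 < mlw)
    (f : Lp ℝ 2 (NonlinearDiffusion.vol Ω)) :
    -- the Poincaré and embedding constants exist
    (∃ CP : ℝ, NonlinearDiffusion.IsPoincareConstant Ω CP) ∧
    (∃ CS : ℝ, NonlinearDiffusion.IsSobolevConstant Ω CS) ∧
    ∀ m ∈ NonlinearDiffusion.diffusivities Ω mlw,
      -- the residual is well defined, with first and second Gâteaux derivatives
      ∃ (R : NonlinearDiffusion.H10 Ω → NonlinearDiffusion.DualH10 Ω)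
        (DR : NonlinearDiffusion.H10 Ω →
          NonlinearDiffusion.H10 Ω →L[ℝ] NonlinearDiffusion.DualH10 Ω)
        (D2R : NonlinearDiffusion.H10 Ω →
          NonlinearDiffusion.H10 Ω →L[ℝ] NonlinearDiffusion.H10 Ω →L[ℝ]
            NonlinearDiffusion.DualH10 Ω),
        NonlinearDiffusion.IsResidual κ₀ α f m R ∧
        NonlinearDiffusion.IsFirstVariation R DR ∧
        NonlinearDiffusion.IsSecondVariation DR D2R ∧
        -- the formulas for the derivatives
        (∀ u p v : NonlinearDiffusion.H10 Ω,
          Integrable (NonlinearDiffusion.firstIntegrand κ₀ α m u p v)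
            (NonlinearDiffusion.vol Ω) ∧
          DR u p v = ∫ x in Ω, NonlinearDiffusion.firstIntegrand κ₀ α m u p v x) ∧
        (∀ u p q v : NonlinearDiffusion.H10 Ω,
          Integrable (NonlinearDiffusion.secondIntegrand α u p q v)
            (NonlinearDiffusion.vol Ω) ∧
          D2R u p q v = ∫ x in Ω, NonlinearDiffusion.secondIntegrand α u p q v x) ∧
        -- the bounds, for every choice of the two constants
        ∀ CP CS : ℝ, NonlinearDiffusion.IsPoincareConstant Ω CP →
          NonlinearDiffusion.IsSobolevConstant Ω CS →
          ∀ u : NonlinearDiffusion.H10 Ω,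
            -- (i) bounds on the first derivative
            (∀ v : NonlinearDiffusion.H10 Ω,
              NonlinearDiffusion.lowerConst κ₀ mlw CP * ‖v‖ ≤ ‖DR u v‖ ∧
              ‖DR u v‖ ≤ NonlinearDiffusion.upperConst κ₀ α CS m u * ‖v‖) ∧
            NonlinearDiffusion.lowerConst κ₀ mlw CP ≤ ‖DR u‖ ∧
            ‖DR u‖ ≤ NonlinearDiffusion.upperConst κ₀ α CS m u ∧
            -- (ii) the first derivative is invertible, with a bound on the inverse
            (∃ A : NonlinearDiffusion.H10 Ω ≃L[ℝ] NonlinearDiffusion.DualH10 Ω,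
              (A : NonlinearDiffusion.H10 Ω →L[ℝ] NonlinearDiffusion.DualH10 Ω) = DR u ∧
              ‖(A.symm : NonlinearDiffusion.DualH10 Ω →L[ℝ] NonlinearDiffusion.H10 Ω)‖
                ≤ 1 / NonlinearDiffusion.lowerConst κ₀ mlw CP) ∧
            -- (iii) bounds on the second derivative
            (∀ p q : NonlinearDiffusion.H10 Ω,
              ‖D2R u p q‖ ≤ NonlinearDiffusion.secondConst α CS u * ‖p‖ * ‖q‖) ∧
            ‖D2R u‖ ≤ NonlinearDiffusion.secondConst α CS u := by
  have hS := NonlinearDiffusion.exists_isSobolevConstant hd1 hd3 hΩ_bdd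
  refine ⟨NonlinearDiffusion.exists_isPoincareConstant hd1 hd3 hΩ_bdd, hS, fun m hm => ?_⟩
  -- One embedding constant is fixed to construct the operators; the bounds are then proved for
  -- arbitrary `CP` and `CS`.
  refine Exists.elim hS fun C hC => ?_
  refine ⟨NonlinearDiffusion.residual hC κ₀ α f m, ?_⟩
  refine ⟨NonlinearDiffusion.residualDeriv hC κ₀ α m, ?_⟩
  refine ⟨NonlinearDiffusion.residualDeriv₂ hC α, ?_⟩
  refine ⟨NonlinearDiffusion.isResidual_residual hC κ₀ α f m, ?_⟩
  refine ⟨NonlinearDiffusion.isFirstVariation_residual hC κ₀ α f m, ?_⟩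
  refine ⟨NonlinearDiffusion.isSecondVariation_residual hC κ₀ α m, ?_⟩
  refine ⟨NonlinearDiffusion.residualDeriv_eq_integral hC κ₀ α m, ?_⟩
  refine ⟨NonlinearDiffusion.residualDeriv₂_eq_integral hC α, fun CP CS hCP hCS u => ?_⟩
  have hcoer := NonlinearDiffusion.residualDeriv_coercive hC hκ₀ hα hmlw hm.2 hCP u
  have := NonlinearDiffusion.nontrivial_H10 hΩ_open hΩ_ne
  refine ⟨fun v => ⟨?_, ?_⟩, ?_, ?_, ?_, ?_, ?_⟩
  · exact NonlinearDiffusion.le_norm_apply_of_coercive hcoer v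
  · exact NonlinearDiffusion.norm_residualDeriv_apply_le hC hκ₀ hα hCS u v
  · exact NonlinearDiffusion.le_norm_of_coercive hcoer
  · exact NonlinearDiffusion.norm_residualDeriv_le hC hκ₀ hα hCS u
  · exact NonlinearDiffusion.exists_equiv_of_coercive
      (NonlinearDiffusion.lowerConst_pos hκ₀ hmlw hCP.1) hcoer
  · exact NonlinearDiffusion.norm_residualDeriv₂_apply_le hC hα hCS u
  · exact NonlinearDiffusion.norm_residualDeriv₂_le hC hα hCS u
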